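/- Let $(A,\mathfrak m)$ be a Cohen–Macaulay local ring (in particular Noetherian) of dimension $d$, let $I$ be a proper ideal of $A$, and let $M\neq 0$ be a finitely generated $A$-module. Let $m=\mu(I)$ be the minimal number of generators of $I$, let $g=\operatorname{grade}(I,M)$ be the supremum of the lengths of $M$-regular sequences contained in $I$, and let $H_i(I,M)$ denote the $i$-th homology module of the Koszul complex $\mathbb K_\bullet(u_1,\dots,u_m;M)$ of a minimal generating set $u_1,\dots,u_m$ of $I$ with coefficients in $M$ (up to isomorphism it does not depend on the choice of $u_1,\dots,u_m$). Then: 1. If $\operatorname{projdim}_A M\le d-g-1$, then $\operatorname{depth} H_{m-g}(I,M)\ge 1$. 2. If $\operatorname{projdim}_A M\le d-g-2$, then $\operatorname{depth} H_{m-g}(I,M)\ge 2$. -/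

import Mathlib

open CategoryTheory

universe u

noncomputable section

/-- The grade of the ideal `I` on the module `M`: the supremum of the lengths of the (weakly)
`M`-regular sequences contained in `I`. If `A` is Noetherian, `M` is finitely generated and
`I M ≠ M`, this is the common length of all maximal `M`-regular sequences in `I`; if `I M = M`
it is `∞`, as usual. -/
def idealGrade {A : Type u} [CommRing A] (I : Ideal A) (M : Type u) [AddCommGroup M] [Module A M] :
    ℕ∞ :=
  ⨆ (rs : List A) (_ : ∀ r ∈ rs, r ∈ I) (_ : RingTheory.Sequence.IsWeaklyRegular M rs),
    (rs.length : ℕ∞)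

/-- The depth of a module over a local ring: the grade of the maximal ideal on it. The zero module
has depth `∞`. -/
def moduleDepth (A : Type u) [CommRing A] [IsLocalRing A] (M : Type u) [AddCommGroup M]
    [Module A M] : ℕ∞ :=
  idealGrade (IsLocalRing.maximalIdeal A) M

/-- A Cohen-Macaulay local ring: a Noetherian local ring whose depth equals its Krull dimension. -/
structure IsCohenMacaulayLocalRing (A : Type u) [CommRing A] [IsLocalRing A] : Prop where
  isNoetherianRing : IsNoetherianRing A
  depth_eq_dim : ((moduleDepth A A : ℕ∞) : WithBot ℕ∞) = ringKrullDim A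

namespace Koszul

variable {A : Type u} [CommRing A] {m : ℕ} (u : Fin m → A) (M : Type u) [AddCommGroup M]
  [Module A M]

/-- The module `⋀ⁱ(Aᵐ) ⊗ M`, in coordinates: the family `f` stands for the element
`∑ e_S ⊗ f S`, where `S = {s₁ < ⋯ < sᵢ}` runs over the `i`-element subsets of `{1, …, m}` and
`e_S = e_{s₁} ∧ ⋯ ∧ e_{sᵢ}`. -/
abbrev Chain (m : ℕ) (M : Type u) (i : ℕ) : Type u :=
  {S : Finset (Fin m) // S.card = i} → M

/-- The set `T ∪ {j}` for `j ∉ T`. -/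
def cons {i : ℕ} (T : {S : Finset (Fin m) // S.card = i}) (j : {j : Fin m // j ∉ T.1}) :
    {S : Finset (Fin m) // S.card = i + 1} :=
  ⟨insert j.1 T.1, by rw [Finset.card_insert_of_notMem j.2, T.2]⟩

/-- The coefficient with which `e_{T ∪ {j}}` contributes to `e_T` under the differential. -/
def coeff (T : Finset (Fin m)) (j : Fin m) : A :=
  (-1) ^ (T.filter (· < j)).card * u j

/-- The Koszul differential, which sends `e_{s₁} ∧ ⋯ ∧ e_{sₙ} ⊗ x` to
`∑ₖ (-1)ᵏ⁻¹ e_{s₁} ∧ ⋯ ∧ (omit e_{sₖ}) ∧ ⋯ ∧ e_{sₙ} ⊗ u_{sₖ} x`. -/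
def differential (i : ℕ) : Chain m M (i + 1) →ₗ[A] Chain m M i where
  toFun f T := ∑ j : {j : Fin m // j ∉ T.1}, coeff u T.1 j.1 • f (cons T j)
  map_add' f g := by
    funext T
    simp [Finset.sum_add_distrib]
  map_smul' a f := by
    funext T
    simp only [Pi.smul_apply, RingHom.id_apply, Finset.smul_sum]
    exact Finset.sum_congr rfl fun j _ => smul_comm _ _ _

theorem coeff_anticomm (T : Finset (Fin m)) {j k : Fin m} (hj : j ∉ T)
    (hjk : j < k) :
    coeff u T j * coeff u (insert j T) k = -(coeff u T k * coeff u (insert k T) j) := by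
  have h1 : ((insert j T).filter (· < k)).card = (T.filter (· < k)).card + 1 := by
    rw [Finset.filter_insert, if_pos hjk, Finset.card_insert_of_notMem (by simp [hj])]
  have h2 : (insert k T).filter (· < j) = T.filter (· < j) := by
    rw [Finset.filter_insert, if_neg (not_lt.mpr hjk.le)]
  unfold coeff
  rw [h1, h2, pow_succ]
  ring

theorem differential_comp (i : ℕ) (f : Chain m M (i + 2)) :
    differential u M i (differential u M (i + 1) f) = 0 := by
  funext T
  change ∑ j : {j : Fin m // j ∉ T.1}, coeff u T.1 j.1 •
    ∑ k : {k : Fin m // k ∉ (cons T j).1}, coeff u (cons T j).1 k.1 • f (cons (cons T j) k) = 0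
  simp only [Finset.smul_sum, smul_smul]
  rw [Finset.sum_sigma']
  have hk : ∀ (j : {j : Fin m // j ∉ T.1}) (k : {k : Fin m // k ∉ (cons T j).1}),
      k.1 ∉ T.1 ∧ k.1 ≠ j.1 := by
    intro j k
    have := k.2
    simp only [cons, Finset.mem_insert, not_or] at this
    exact ⟨this.2, this.1⟩
  refine Finset.sum_involution
    (fun p _ => ⟨⟨p.2.1, (hk p.1 p.2).1⟩, ⟨p.1.1, ?_⟩⟩) ?_ ?_ ?_ ?_
  · simp only [cons, Finset.mem_insert, not_or]
    exact ⟨(hk p.1 p.2).2.symm, p.1.2⟩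
  · rintro ⟨j, k⟩ _
    obtain ⟨h1, h2⟩ := hk j k
    have hc : ∀ (x y : {S : Finset (Fin m) // S.card = i + 1 + 1}), x.1 = y.1 → f x = f y :=
      fun x y h => congrArg f (Subtype.ext h)
    have e : coeff u T.1 j.1 * coeff u (insert j.1 T.1) k.1 =
        -(coeff u T.1 k.1 * coeff u (insert k.1 T.1) j.1) := by
      rcases lt_or_gt_of_ne h2 with h | h
      · rw [coeff_anticomm u T.1 h1 h, neg_neg]
      · exact coeff_anticomm u T.1 j.2 h
    dsimp only
    rw [hc (cons (cons T ⟨k.1, h1⟩) ⟨j.1, _⟩) (cons (cons T j) k)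
      (Finset.insert_comm j.1 k.1 T.1), ← add_smul]
    simp only [cons] at e ⊢
    rw [e, neg_add_cancel, zero_smul]
  · rintro ⟨j, k⟩ _ _ h
    exact (hk j k).2 (congrArg (fun p => p.1.1) h)
  · rintro ⟨j, k⟩ _
    simp
  · rintro ⟨j, k⟩ _
    rfl

/-- The Koszul chain complex `K(u, M)` of the sequence `u₁, …, uₘ` with coefficients in `M`. -/
def complex : ChainComplex (ModuleCat.{u} A) ℕ :=
  ChainComplex.of (fun i => ModuleCat.of A (Chain m M i))
    (fun i => ModuleCat.ofHom (differential u M i))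
    (fun i => by
      refine ModuleCat.hom_ext (LinearMap.ext fun f => ?_)
      exact differential_comp u M i f)

/-- The Koszul homology module `H_i(u, M)`. -/
abbrev homology (i : ℕ) : ModuleCat.{u} A :=
  (complex u M).homology i

end Koszul

end

/-! Let `N` be the quotient of `M` by a regular sequence of length `g` in `I`. Since `I` kills
Koszul homology, connecting homomorphisms identify `H_{m-g}(I, M)` with the top homology `H_m(I,
N)`, which is the submodule of `N` killed by `I` (`exists_homology_top_iso`). Top homology is left
exact in `N`, so a weakly regular sequence of length at most two on `N` stays so on it
(`isWeaklyRegular_pair_homology_top`); left exactness gives no more than two.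

It remains to bound the depth of `N` below. Only the inequality in Auslander–Buchsbaum is needed,
and depth is read off as vanishing of Koszul homology of generators of the maximal ideal in the top
degrees (`VanishesOnTop`). Projectives inherit `d` vanishing degrees from `A`; each syzygy step
costs one (`of_hasProjectiveDimensionLE`), and so does each element divided out of `M`. Conversely,
vanishing yields a regular sequence (`exists_isWeaklyRegular`). -/

namespace Koszul

variable {A : Type u} [CommRing A] {m : ℕ}

/-! ### Functoriality and exactness in the coefficient module -/

theorem complex_d (x : Fin m → A) (M : Type u) [AddCommGroup M] [Module A M] (i : ℕ) :
    (complex x M).d (i + 1) i = ModuleCat.ofHom (differential x M i) :=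
  ChainComplex.of_d (fun i => ModuleCat.of A (Chain m M i))
    (fun i => ModuleCat.ofHom (differential x M i)) i

/-- The chain map of Koszul complexes induced by a linear map of coefficient modules. -/
noncomputable def complexMap (x : Fin m → A) {M N : ModuleCat.{u} A} (f : M ⟶ N) :
    complex x M ⟶ complex x N :=
  ChainComplex.ofHom (fun i => ModuleCat.ofHom (f.hom.compLeft {S : Finset (Fin m) // S.card = i}))
    (fun i => by
      rw [complex_d, complex_d]
      refine ModuleCat.hom_ext (LinearMap.ext fun c => funext fun T => ?_)
      change ∑ j : {j : Fin m // j ∉ T.1}, coeff x T.1 j.1 • f.hom (c (cons T j)) =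
        f.hom (∑ j : {j : Fin m // j ∉ T.1}, coeff x T.1 j.1 • c (cons T j))
      simp)

/-- The short complex of Koszul complexes induced by a short complex of coefficient modules. -/
noncomputable def shortComplex (x : Fin m → A) (S : ShortComplex (ModuleCat.{u} A)) :
    ShortComplex (ChainComplex (ModuleCat.{u} A) ℕ) :=
  ShortComplex.mk (complexMap x S.f) (complexMap x S.g) (by
    ext i : 1
    refine ModuleCat.hom_ext (LinearMap.ext fun c => funext fun T => ?_)
    exact S.moduleCat_zero_apply (c T))

theorem shortComplex_shortExact (x : Fin m → A) {S : ShortComplex (ModuleCat.{u} A)}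
    (hS : S.ShortExact) : (shortComplex x S).ShortExact := by
  refine HomologicalComplex.shortExact_of_degreewise_shortExact _ fun i => ?_
  refine ModuleCat.shortComplex_shortExact _ ?_ ?_ ?_
  · have h := (ShortComplex.ShortExact.moduleCat_exact_iff_function_exact _).mp hS.exact
    intro c
    constructor
    · intro hc
      choose b hb using fun T => (h (c T)).mp (congrFun hc T)
      exact ⟨b, funext hb⟩
    · rintro ⟨b, rfl⟩
      exact funext fun T => (h _).mpr ⟨b T, rfl⟩
  · intro a b hab
    exact funext fun T => hS.moduleCat_injective_f (congrFun hab T)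
  · intro c
    choose b hb using fun T => hS.moduleCat_surjective_g (c T)
    exact ⟨b, funext hb⟩

theorem isZero_homology_of_lt (x : Fin m → A) (M : ModuleCat.{u} A) {i : ℕ} (hi : m < i) :
    Limits.IsZero (homology x M i) := by
  refine ShortComplex.isZero_homology_of_isZero_X₂ _ ?_
  refine @ModuleCat.isZero_of_subsingleton _ _ _ ?_
  change Subsingleton (Chain m M i)
  have : IsEmpty {S : Finset (Fin m) // S.card = i} :=
    ⟨fun S => by have := S.1.card_le_univ; simp [S.2] at this; lia⟩
  infer_instance

/-! ### Exterior multiplication as a homotopy: the ideal kills Koszul homology -/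

/-- The sign with which `e_{S ∖ {k}}` contributes to `e_S` under multiplication by `e_k`. -/
def sign (A : Type u) [CommRing A] (S : Finset (Fin m)) (k : Fin m) : A :=
  (-1) ^ (S.filter (· < k)).card

/-- Removing an element from a subset. -/
def erase {i : ℕ} (S : {S : Finset (Fin m) // S.card = i + 1}) (k : {k : Fin m // k ∈ S.1}) :
    {S : Finset (Fin m) // S.card = i} :=
  ⟨S.1.erase k.1, by rw [Finset.card_erase_of_mem k.2, S.2, Nat.add_sub_cancel]⟩

/-- Left multiplication by the basis vector `e_k` on the Koszul complex. -/
noncomputable def wedge (A : Type u) [CommRing A] (M : Type u) [AddCommGroup M] [Module A M]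
    (k : Fin m) (i : ℕ) : Chain m M i →ₗ[A] Chain m M (i + 1) where
  toFun f S := if hk : k ∈ S.1 then sign A S.1 k • f (erase S ⟨k, hk⟩) else 0
  map_add' f g := by
    funext S
    by_cases hk : k ∈ S.1 <;> simp [hk]
  map_smul' a f := by
    funext S
    by_cases hk : k ∈ S.1
    · simpa [hk] using smul_comm _ _ _
    · simp [hk]

section

variable (x : Fin m → A) {M : Type u} [AddCommGroup M] [Module A M] (k : Fin m)

theorem differential_wedge_of_notMem {i : ℕ} (f : Chain m M i)
    (T : {S : Finset (Fin m) // S.card = i}) (hk : k ∉ T.1) :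
    differential x M i (wedge A M k i f) T = x k • f T := by
  change ∑ j : {j : Fin m // j ∉ T.1}, coeff x T.1 j.1 • wedge A M k i f (cons T j) = _
  rw [Finset.sum_eq_single ⟨k, hk⟩]
  · have hmem : k ∈ (cons T ⟨k, hk⟩).1 := Finset.mem_insert_self _ _
    have he : erase (cons T ⟨k, hk⟩) ⟨k, hmem⟩ = T :=
      Subtype.ext (Finset.erase_insert hk)
    simp only [wedge, LinearMap.coe_mk, AddHom.coe_mk, hmem, dif_pos, he, smul_smul]
    congr 1
    simp only [coeff, sign, cons, Finset.filter_insert, lt_irrefl, if_false]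
    rw [mul_right_comm, ← mul_pow]
    simp
  · rintro ⟨j, hj⟩ _ hne
    have : k ∉ (cons T ⟨j, hj⟩).1 := by
      simp only [cons, Finset.mem_insert, not_or]
      exact ⟨fun h => hne (Subtype.ext h.symm), hk⟩
    simp only [wedge, LinearMap.coe_mk, AddHom.coe_mk, this, dif_neg, not_false_iff, smul_zero]
  · simp

theorem sign_mul_self (S : Finset (Fin m)) : sign A S k * sign A S k = 1 := by
  simp [sign, ← mul_pow]

theorem coeff_mul_sign (T : Finset (Fin m)) (hk : k ∈ T) {j : Fin m} (hj : j ∉ T) :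
    coeff x T j * sign A (insert j T) k = -(sign A T k * coeff x (T.erase k) j) := by
  have hkT : k ∉ T.erase k := Finset.notMem_erase k T
  have hjT : j ∉ T.erase k := fun h => hj (Finset.mem_of_mem_erase h)
  have hjk : j ≠ k := by rintro rfl; exact hj hk
  obtain ⟨R, hR, rfl⟩ : ∃ R, k ∉ R ∧ T = insert k R :=
    ⟨T.erase k, hkT, (Finset.insert_erase hk).symm⟩
  rw [Finset.erase_insert hR] at *
  simp only [coeff, sign, Finset.filter_insert, lt_irrefl, if_false]
  rcases lt_or_gt_of_ne hjk with h | h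
  · rw [if_neg (not_lt.mpr h.le), if_pos h, Finset.card_insert_of_notMem (by simp [hjT])]
    ring
  · rw [if_pos h, if_neg (not_lt.mpr h.le), Finset.card_insert_of_notMem (by simp [hR])]
    ring

/-- The identity `d(e_k ∧ f) + e_k ∧ df = x_k f`, read at an index set containing `k`, where the
cycle condition is needed. -/
theorem differential_wedge_of_mem {i : ℕ} (f : Chain m M (i + 1))
    (hf : differential x M i f = 0) (T : {S : Finset (Fin m) // S.card = i + 1}) (hk : k ∈ T.1) :
    differential x M (i + 1) (wedge A M k (i + 1) f) T = x k • f T := by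
  have h0 := congrFun hf (erase T ⟨k, hk⟩)
  change ∑ j : {j : Fin m // j ∉ T.1.erase k},
    coeff x (T.1.erase k) j.1 • f (cons (erase T ⟨k, hk⟩) j) = 0 at h0
  change ∑ j : {j : Fin m // j ∉ T.1}, coeff x T.1 j.1 • wedge A M k (i + 1) f (cons T j) = _
  -- The terms of `df = 0` at `T ∖ {k}`. Those with `j ∉ T` match the terms of the goal up to sign;
  -- the one left over, `j = k`, produces `x k • f T`.
  set F : Fin m → M := fun j => if hj : j ∉ T.1.erase k then
    coeff x (T.1.erase k) j • f (cons (erase T ⟨k, hk⟩) ⟨j, hj⟩) else 0 with hF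
  have h1 : ∑ j : {j : Fin m // j ∉ T.1.erase k}, F j.1 = 0 := by
    rw [← h0]
    refine Finset.sum_congr rfl fun j _ => ?_
    simp only [hF, dif_pos j.2]
    rfl
  have h2 : ∀ j : {j : Fin m // j ∉ T.1},
      coeff x T.1 j.1 • wedge A M k (i + 1) f (cons T j) = -(sign A T.1 k • F j.1) := by
    rintro ⟨j, hj⟩
    have hmem : k ∈ (cons T ⟨j, hj⟩).1 := Finset.mem_insert_of_mem hk
    have hjT : j ∉ T.1.erase k := fun h => hj (Finset.mem_of_mem_erase h)
    have hjk : j ≠ k := by rintro rfl; exact hj hk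
    have he : erase (cons T ⟨j, hj⟩) ⟨k, hmem⟩ = cons (erase T ⟨k, hk⟩) ⟨j, hjT⟩ :=
      Subtype.ext (Finset.erase_insert_of_ne hjk)
    simp only [wedge, LinearMap.coe_mk, AddHom.coe_mk, hmem, dif_pos, he, smul_smul, hF, hjT,
      not_false_iff]
    rw [← neg_smul]
    congr 1
    exact coeff_mul_sign x k T.1 hk hj
  have h3 : F k = (sign A T.1 k * x k) • f T := by
    have hkT : k ∉ T.1.erase k := Finset.notMem_erase k _
    have he : cons (erase T ⟨k, hk⟩) ⟨k, hkT⟩ = T := Subtype.ext (Finset.insert_erase hk)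
    simp only [hF, dif_pos hkT, he]
    congr 1
    simp only [coeff, sign]
    rw [Finset.filter_erase, Finset.erase_eq_of_notMem (by simp)]
  have h4 : ∑ j : {j : Fin m // j ∉ T.1}, F j.1 = -F k := by
    have e1 : ∑ j ∈ Finset.univ.filter (· ∉ T.1), F j = ∑ j : {j : Fin m // j ∉ T.1}, F j.1 :=
      Finset.sum_subtype _ (by simp) F
    have e2 : ∑ j ∈ Finset.univ.filter (· ∉ T.1.erase k), F j =
        ∑ j : {j : Fin m // j ∉ T.1.erase k}, F j.1 :=
      Finset.sum_subtype _ (by simp) F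
    have e3 : Finset.univ.filter (· ∉ T.1.erase k) = insert k (Finset.univ.filter (· ∉ T.1)) := by
      ext j
      simp only [Finset.mem_filter, Finset.mem_univ, true_and, Finset.mem_erase, Finset.mem_insert]
      tauto
    rw [h1, e3, Finset.sum_insert (by simpa using hk), e1] at e2
    exact eq_neg_of_add_eq_zero_right e2
  rw [Finset.sum_congr rfl fun j _ => h2 j, Finset.sum_neg_distrib, ← Finset.smul_sum, h4, h3,
    smul_neg, neg_neg, smul_smul, ← mul_assoc, sign_mul_self, one_mul]

theorem differential_wedge_of_cycle {i : ℕ} (f : Chain m M (i + 1))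
    (hf : differential x M i f = 0) :
    differential x M (i + 1) (wedge A M k (i + 1) f) = x k • f := by
  funext T
  by_cases hk : k ∈ T.1
  · exact differential_wedge_of_mem x k f hf T hk
  · exact differential_wedge_of_notMem x k f T hk

theorem differential_wedge_zero (f : Chain m M 0) :
    differential x M 0 (wedge A M k 0 f) = x k • f := by
  funext T
  refine differential_wedge_of_notMem x k f T ?_
  rw [Finset.card_eq_zero.mp T.2]
  exact Finset.notMem_empty k

end

theorem homologyMap_complexMap_smul (x : Fin m → A) (M : ModuleCat.{u} A) (r : A) (i : ℕ) :
    HomologicalComplex.homologyMap (complexMap x (r • 𝟙 M)) i = r • 𝟙 (homology x M i) := by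
  have h : complexMap x (r • 𝟙 M) = r • 𝟙 (complex x M) := by
    ext i : 1
    rfl
  rw [h]
  have := ShortComplex.homologyMap_smul
    ((HomologicalComplex.shortComplexFunctor _ _ i).map (𝟙 (complex x M))) r
  refine this.trans ?_
  congr 1
  exact HomologicalComplex.homologyMap_id _ i

theorem exists_toCycles_eq_smul (x : Fin m → A) (M : ModuleCat.{u} A) (k : Fin m) (i : ℕ)
    (z : (complex x M).cycles i) :
    ∃ w : (complex x M).X (i + 1), (complex x M).toCycles (i + 1) i w = x k • z := by
  have hinj : Function.Injective ((complex x M).iCycles i) :=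
    (ModuleCat.mono_iff_injective _).mp inferInstance
  refine ⟨wedge A M k i ((complex x M).iCycles i z), hinj ?_⟩
  have h1 : ∀ w, (complex x M).iCycles i ((complex x M).toCycles (i + 1) i w) =
      differential x M i w := fun w => by
    rw [← ModuleCat.comp_apply, HomologicalComplex.toCycles_i, complex_d]
    rfl
  refine (h1 _).trans ((?_ : _ = x k • (complex x M).iCycles i z).trans (map_smul _ _ _).symm)
  cases i with
  | zero => exact differential_wedge_zero x k _
  | succ i =>
    refine differential_wedge_of_cycle x k _ ?_
    have := ConcreteCategory.congr_hom ((complex x M).iCycles_d (i + 1) i) z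
    rw [complex_d] at this
    exact this

theorem smul_homology_eq_zero (x : Fin m → A) (M : ModuleCat.{u} A) {r : A}
    (hr : r ∈ Ideal.span (Set.range x)) (i : ℕ) (h : homology x M i) : r • h = 0 := by
  suffices H : Ideal.span (Set.range x) ≤ Module.annihilator A (homology x M i) from
    Module.mem_annihilator.mp (H hr) h
  rw [Ideal.span_le]
  rintro _ ⟨k, rfl⟩
  refine Module.mem_annihilator.mpr fun h => ?_
  obtain ⟨z, rfl⟩ := (ModuleCat.epi_iff_surjective ((complex x M).homologyπ i)).mp inferInstance h
  obtain ⟨w, hw⟩ := exists_toCycles_eq_smul x M k i z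
  rw [← map_smul, ← hw, ← ModuleCat.comp_apply, HomologicalComplex.toCycles_comp_homologyπ]
  rfl

/-! ### Consequences of the long exact homology sequence -/

section LongExactSequence

variable (x : Fin m → A) {S : ShortComplex (ModuleCat.{u} A)} (hS : S.ShortExact)

include hS

theorem isZero_homology_X₃ {i : ℕ} (h₁ : Limits.IsZero (homology x S.X₁ i))
    (h₂ : Limits.IsZero (homology x S.X₂ (i + 1))) : Limits.IsZero (homology x S.X₃ (i + 1)) :=
  ((shortComplex_shortExact x hS).homology_exact₃ (i + 1) i rfl).isZero_of_both_zeros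
    (h₂.eq_zero_of_src _) (h₁.eq_zero_of_tgt _)

theorem isZero_homology_X₃_zero (h₂ : Limits.IsZero (homology x S.X₂ 0)) :
    Limits.IsZero (homology x S.X₃ 0) := by
  have : Epi (HomologicalComplex.homologyMap (shortComplex x S).g 0) := by
    have := (shortComplex_shortExact x hS).epi_g
    exact HomologicalComplex.epi_homologyMap_of_epi_of_not_rel _ 0 (by simp)
  exact @Limits.IsZero.of_epi _ _ _ _ _ _ this h₂

end LongExactSequence

section QuotSMulTop

variable (x : Fin m → A) (M : ModuleCat.{u} A) {r : A} (hr : IsSMulRegular M r)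

include hr

theorem isZero_homology_of_quotSMulTop (hrx : r ∈ Ideal.span (Set.range x)) {i : ℕ}
    (h : Limits.IsZero (homology x (QuotSMulTop r M) (i + 1))) :
    Limits.IsZero (homology x M i) := by
  -- Multiplication by `r` is zero on `H_i(x, M)`, so the connecting map onto it from `H_{i+1}(x,
  -- M/rM)` is surjective.
  have hS := shortComplex_shortExact x hr.smulShortComplex_shortExact
  refine (hS.homology_exact₁ (i + 1) i rfl).isZero_of_both_zeros (h.eq_zero_of_src _) ?_
  change HomologicalComplex.homologyMap (complexMap x (M.smulShortComplex r).f) i = 0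
  rw [M.smulShortComplex_f_eq_smul_id]
  refine (homologyMap_complexMap_smul x M r i).trans ?_
  ext h
  exact smul_homology_eq_zero x M hrx i h

/-- The isomorphism `H_{i+1}(x, M/rM) ≅ H_i(x, M)` given by the connecting homomorphism, for an
`M`-regular element `r` of the ideal `(x)`, if `H_{i+1}(x, M) = 0`. -/
noncomputable def homologyQuotSMulTopIso (hrx : r ∈ Ideal.span (Set.range x)) {i : ℕ}
    (h : Limits.IsZero (homology x M (i + 1))) :
    homology x (QuotSMulTop r M) (i + 1) ≅ homology x M i := by
  have hS := shortComplex_shortExact x hr.smulShortComplex_shortExact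
  have : Mono (hS.δ (i + 1) i rfl) := hS.mono_δ _ _ rfl h
  have : Epi (hS.δ (i + 1) i rfl) := by
    refine (hS.homology_exact₁ (i + 1) i rfl).epi_f ?_
    change HomologicalComplex.homologyMap (complexMap x (M.smulShortComplex r).f) i = 0
    rw [M.smulShortComplex_f_eq_smul_id]
    refine (homologyMap_complexMap_smul x M r i).trans ?_
    ext h
    exact smul_homology_eq_zero x M hrx i h
  have : IsIso (hS.δ (i + 1) i rfl) := isIso_of_mono_of_epi _
  exact @asIso _ _ _ _ (hS.δ (i + 1) i rfl) this

end QuotSMulTop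

end Koszul

/-! ### Grade as a supremum -/

theorem le_idealGrade {A : Type u} [CommRing A] {I : Ideal A} {M : Type u} [AddCommGroup M]
    [Module A M] {rs : List A} (hI : ∀ r ∈ rs, r ∈ I)
    (hrs : RingTheory.Sequence.IsWeaklyRegular M rs) : (rs.length : ℕ∞) ≤ idealGrade I M :=
  le_iSup₂_of_le (f := fun rs (_ : ∀ r ∈ rs, r ∈ I) =>
    ⨆ (_ : RingTheory.Sequence.IsWeaklyRegular M rs), (rs.length : ℕ∞)) rs hI
    (le_iSup_of_le hrs le_rfl)

theorem exists_isWeaklyRegular_of_le_idealGrade {A : Type u} [CommRing A] {I : Ideal A}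
    {M : Type u} [AddCommGroup M] [Module A M] {n : ℕ} (h : (n : ℕ∞) ≤ idealGrade I M) :
    ∃ rs : List A, rs.length = n ∧ (∀ r ∈ rs, r ∈ I) ∧
      RingTheory.Sequence.IsWeaklyRegular M rs := by
  cases n with
  | zero => exact ⟨[], rfl, by simp, .nil A M⟩
  | succ n =>
    -- A strict bound below a supremum is witnessed by some list, even when the grade is infinite;
    -- truncation then gives the exact length.
    have h' : (n : ℕ∞) < idealGrade I M := lt_of_lt_of_le (by exact_mod_cast n.lt_succ_self) h
    simp only [idealGrade, lt_iSup_iff, Nat.cast_lt] at h'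
    obtain ⟨rs, hI, hrs, hlen⟩ := h'
    refine ⟨rs.take (n + 1), by simpa using hlen, fun r hr => hI r (List.mem_of_mem_take hr), ?_⟩
    rw [← List.take_append_drop (n + 1) rs, RingTheory.Sequence.isWeaklyRegular_append_iff] at hrs
    exact hrs.1

theorem idealGrade_congr {A : Type u} [CommRing A] (I : Ideal A) {M N : Type u} [AddCommGroup M]
    [Module A M] [AddCommGroup N] [Module A N] (e : M ≃ₗ[A] N) :
    idealGrade I M = idealGrade I N := by
  simp only [idealGrade, e.isWeaklyRegular_congr]

theorem idealGrade_eq_top_of_subsingleton {A : Type u} [CommRing A] (I : Ideal A) (M : Type u)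
    [AddCommGroup M] [Module A M] [Subsingleton M] : idealGrade I M = ⊤ := by
  refine ENat.eq_top_iff_forall_ge.mpr fun n => ?_
  have h : RingTheory.Sequence.IsWeaklyRegular M (List.replicate n (0 : A)) :=
    ⟨fun i hi => fun a b _ => Subsingleton.elim a b⟩
  simpa using le_idealGrade (I := I) (fun r hr => by simp_all) h

/-! ### Depth as vanishing of Koszul homology in the top degrees -/

namespace Koszul

variable {A : Type u} [CommRing A] {m : ℕ}

/-- The Koszul homology of `M` vanishes in the `t` topmost degrees `m, m - 1, …, m - t + 1`. -/
def VanishesOnTop (x : Fin m → A) (M : ModuleCat.{u} A) (t : ℕ) : Prop :=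
  ∀ j, m < j + t → Limits.IsZero (homology x M j)

theorem VanishesOnTop.mono {x : Fin m → A} {M : ModuleCat.{u} A} {s t : ℕ}
    (h : VanishesOnTop x M t) (hst : s ≤ t) : VanishesOnTop x M s :=
  fun j hj => h j (by lia)

theorem VanishesOnTop.of_subsingleton (x : Fin m → A) (M : ModuleCat.{u} A) [Subsingleton M]
    (t : ℕ) : VanishesOnTop x M t := by
  refine fun j _ => ShortComplex.isZero_homology_of_isZero_X₂ _ ?_
  refine @ModuleCat.isZero_of_subsingleton _ _ _ ?_
  change Subsingleton (Chain m M j)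
  infer_instance

theorem VanishesOnTop.X₃ {x : Fin m → A} {S : ShortComplex (ModuleCat.{u} A)} (hS : S.ShortExact)
    {t : ℕ} (h₁ : VanishesOnTop x S.X₁ (t + 1)) (h₂ : VanishesOnTop x S.X₂ t) :
    VanishesOnTop x S.X₃ t := by
  rintro (_ | j) hj
  · exact isZero_homology_X₃_zero x hS (h₂ 0 hj)
  · exact isZero_homology_X₃ x hS (h₁ j (by lia)) (h₂ (j + 1) hj)

theorem VanishesOnTop.quotSMulTop {x : Fin m → A} {M : ModuleCat.{u} A} {t : ℕ}
    (h : VanishesOnTop x M (t + 1)) {r : A} (hr : IsSMulRegular M r) :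
    VanishesOnTop x (ModuleCat.of A (QuotSMulTop r M)) t :=
  .X₃ (S := M.smulShortComplex r) hr.smulShortComplex_shortExact h (h.mono t.le_succ)

theorem VanishesOnTop.of_isWeaklyRegular (x : Fin m → A) (M : ModuleCat.{u} A) (rs : List A)
    (hx : ∀ r ∈ rs, r ∈ Ideal.span (Set.range x))
    (hrs : RingTheory.Sequence.IsWeaklyRegular M rs) : VanishesOnTop x M rs.length := by
  induction rs generalizing M with
  | nil => exact fun j hj => isZero_homology_of_lt x M (by simpa using hj)
  | cons r rs ih =>
    rw [RingTheory.Sequence.isWeaklyRegular_cons_iff] at hrs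
    rw [List.forall_mem_cons] at hx
    intro j hj
    rw [List.length_cons] at hj
    exact isZero_homology_of_quotSMulTop x M hrs.1 hx.1
      (ih (ModuleCat.of A (QuotSMulTop r M)) hx.2 hrs.2 (j + 1) (by lia))

/-- There are no boundaries in degree `m`, so `H_m(x, M)` is the submodule of `M` killed by all `x
k`. -/
theorem eq_zero_of_isZero_homology_top (x : Fin m → A) (M : ModuleCat.{u} A)
    (h : Limits.IsZero (homology x M m)) (n : M) (hn : ∀ k, x k • n = 0) : n = 0 := by
  have hex := (ShortComplex.exact_iff_isZero_homology _).mpr h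
  rw [ShortComplex.moduleCat_exact_iff] at hex
  obtain ⟨w, hw⟩ := hex (fun _ => n : Chain m M m) (by
    change (complex x M).d m ((ComplexShape.down ℕ).next m) (fun _ => n : Chain m M m) = 0
    generalize (ComplexShape.down ℕ).next m = j
    by_cases hj : j + 1 = m
    · have hd : ∀ i (_ : i = j + 1), (complex x M).d i j (fun _ => n : Chain m M i) = 0 := by
        rintro _ rfl
        rw [complex_d]
        funext T
        change ∑ k : {k : Fin m // k ∉ T.1}, coeff x T.1 k.1 • n = 0
        exact Finset.sum_eq_zero fun k _ => by rw [coeff, mul_smul, hn, smul_zero]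
      exact hd m hj.symm
    · rw [(complex x M).shape _ _ hj]
      rfl)
  have hX : Subsingleton ((complex x M).X ((ComplexShape.down ℕ).prev m)) := by
    rw [ChainComplex.prev]
    change Subsingleton (Chain m M (m + 1))
    have : IsEmpty {S : Finset (Fin m) // S.card = m + 1} :=
      ⟨fun S => by have := S.1.card_le_univ; simp [S.2] at this⟩
    infer_instance
  have hw0 : w = 0 := hX.elim _ _
  rw [hw0, map_zero] at hw
  exact (congrFun hw ⟨Finset.univ, by simp⟩).symm

theorem VanishesOnTop.exists_isWeaklyRegular [IsLocalRing A] [IsNoetherianRing A] {x : Fin m → A}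
    (hx : Ideal.span (Set.range x) = IsLocalRing.maximalIdeal A) (M : ModuleCat.{u} A)
    [Module.Finite A M] {t : ℕ} (h : VanishesOnTop x M t) :
    ∃ rs : List A, rs.length = t ∧ (∀ r ∈ rs, r ∈ IsLocalRing.maximalIdeal A) ∧
      RingTheory.Sequence.IsWeaklyRegular M rs := by
  induction t generalizing M with
  | zero => exact ⟨[], rfl, by simp, .nil A M⟩
  | succ t ih =>
    -- A map from the residue field picks out an element killed by the maximal ideal; the absence of
    -- nonzero ones gives an `M`-regular element there.
    have : Subsingleton (A ⧸ IsLocalRing.maximalIdeal A →ₗ[A] M) := by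
      refine subsingleton_of_forall_eq 0 fun φ => ?_
      refine Submodule.linearMap_qext _ (LinearMap.ext_ring ?_)
      refine eq_zero_of_isZero_homology_top x M (h m (by lia)) _ fun k => ?_
      have hk : x k ∈ IsLocalRing.maximalIdeal A := hx ▸ Ideal.subset_span ⟨k, rfl⟩
      rw [← map_smul, LinearMap.comp_apply, Submodule.mkQ_apply, smul_eq_mul, mul_one,
        (Submodule.Quotient.mk_eq_zero _).mpr hk, map_zero]
    obtain ⟨r, hr, hreg⟩ := IsSMulRegular.subsingleton_linearMap_iff.mp this
    rw [Ideal.annihilator_quotient] at hr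
    obtain ⟨rs, hlen, hmem, hrs⟩ := ih (ModuleCat.of A (QuotSMulTop r M)) (h.quotSMulTop hreg)
    exact ⟨r :: rs, by simp [hlen], List.forall_mem_cons.mpr ⟨hr, hmem⟩, hrs.cons hreg⟩

theorem VanishesOnTop.of_projective {x : Fin m → A} {rs : List A}
    (hx : ∀ r ∈ rs, r ∈ Ideal.span (Set.range x)) (hrs : RingTheory.Sequence.IsWeaklyRegular A rs)
    (P : ModuleCat.{u} A) [Projective P] : VanishesOnTop x P rs.length := by
  have : Module.Projective A P := (IsProjective.iff_projective P).mpr inferInstance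
  exact .of_isWeaklyRegular x P rs hx
    (((TensorProduct.rid A P).isWeaklyRegular_congr rs).mp hrs.isWeaklyRegular_lTensor)

/-- Induction along syzygies: in `0 → K → P → M → 0`, the kernel has smaller projective dimension
and one more vanishing degree, which the connecting map spends. -/
theorem VanishesOnTop.of_hasProjectiveDimensionLE {x : Fin m → A} {rs : List A}
    (hx : ∀ r ∈ rs, r ∈ Ideal.span (Set.range x)) (hrs : RingTheory.Sequence.IsWeaklyRegular A rs)
    (n t : ℕ) (hnt : n + t ≤ rs.length) (M : ModuleCat.{u} A) [HasProjectiveDimensionLT M (n + 1)] :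
    VanishesOnTop x M t := by
  induction n generalizing M t with
  | zero =>
    have : Projective M := projective_iff_hasProjectiveDimensionLT_one.mpr ‹_›
    exact (of_projective hx hrs M).mono (by lia)
  | succ n ih =>
    let S := ShortComplex.mk (Limits.kernel.ι (Projective.π M)) (Projective.π M)
      (Limits.kernel.condition _)
    have hS : S.ShortExact := { exact := ShortComplex.exact_kernel _ }
    have : Projective S.X₂ := Projective.projective_over M
    have : HasProjectiveDimensionLT S.X₁ (n + 1) :=
      (hS.hasProjectiveDimensionLT_X₃_iff n this).mp ‹_›
    exact .X₃ hS (ih (t + 1) (by lia) S.X₁) ((of_projective hx hrs S.X₂).mono (by lia))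

theorem VanishesOnTop.of_projectiveDimension_add_le {x : Fin m → A} {rs : List A}
    (hx : ∀ r ∈ rs, r ∈ Ideal.span (Set.range x)) (hrs : RingTheory.Sequence.IsWeaklyRegular A rs)
    (t : ℕ) (M : ModuleCat.{u} A) (h : projectiveDimension M + (t : ℕ) ≤ rs.length) :
    VanishesOnTop x M t := by
  generalize hp : projectiveDimension M = p at h
  induction p with
  -- Projective dimension `⊥` means the zero module; the value `⊤` is excluded by the finite bound.
  | bot =>
    have := ModuleCat.isZero_iff_subsingleton.mp ((projectiveDimension_eq_bot_iff M).mp hp)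
    exact .of_subsingleton x M t
  | coe p =>
    induction p with
    | top =>
      have h' : (⊤ + t : ℕ∞) ≤ rs.length := WithBot.coe_le_coe.mp h
      rw [top_add, top_le_iff] at h'
      exact absurd h' (ENat.natCast_ne_top _)
    | coe n =>
      have : HasProjectiveDimensionLT M (n + 1) := (projectiveDimension_le_iff M n).mp hp.le
      exact .of_hasProjectiveDimensionLE hx hrs n t (by exact_mod_cast h) M

/-! ### Reduction to top homology and its regular sequences -/

theorem exists_homology_top_iso (x : Fin m → A) (M : ModuleCat.{u} A) [Module.Finite A M]
    (rs : List A) (hx : ∀ r ∈ rs, r ∈ Ideal.span (Set.range x))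
    (hrs : RingTheory.Sequence.IsWeaklyRegular M rs) (j : ℕ) (hj : j + rs.length = m) :
    ∃ N : ModuleCat.{u} A, Module.Finite A N ∧ Nonempty (homology x N m ≅ homology x M j) ∧
      ∀ {n : ℕ} (y : Fin n → A) (t : ℕ), VanishesOnTop y M (t + rs.length) →
        VanishesOnTop y N t := by
  induction rs generalizing M j with
  | nil =>
    obtain rfl : j = m := hj
    exact ⟨M, ‹_›, ⟨Iso.refl _⟩, fun y t h => h⟩
  | cons r rs ih =>
    have hM := VanishesOnTop.of_isWeaklyRegular x M _ hx hrs
    rw [RingTheory.Sequence.isWeaklyRegular_cons_iff] at hrs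
    rw [List.forall_mem_cons] at hx
    rw [List.length_cons] at hj hM
    obtain ⟨N, hN, ⟨e⟩, hV⟩ :=
      ih (ModuleCat.of A (QuotSMulTop r M)) hx.2 hrs.2 (j + 1) (by lia)
    exact ⟨N, hN, ⟨e ≪≫ homologyQuotSMulTopIso x M hrs.1 hx.1 (hM (j + 1) (by lia))⟩,
      fun y t h => hV y t (VanishesOnTop.quotSMulTop h hrs.1)⟩

/-- The kernel of `a` on `H_m(x, N)` is the image of `H_{m+1}(x, N/aN)`, which is zero. -/
theorem isSMulRegular_homology_top (x : Fin m → A) (N : ModuleCat.{u} A) {a : A}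
    (ha : IsSMulRegular N a) : IsSMulRegular (homology x N m) a := by
  have hS := shortComplex_shortExact x ha.smulShortComplex_shortExact
  have : Mono (HomologicalComplex.homologyMap (complexMap x (a • 𝟙 N)) m) :=
    (hS.homology_exact₁ (m + 1) m rfl).mono_g
      ((isZero_homology_of_lt x (ModuleCat.of A (QuotSMulTop a N)) m.lt_succ_self).eq_zero_of_src _)
  rw [homologyMap_complexMap_smul] at this
  exact (ModuleCat.mono_iff_injective _).mp this

/-- Exactness embeds `H_m(x, N)/a` into `H_m(x, N/aN)`, where `b` is regular. -/
theorem isWeaklyRegular_pair_homology_top (x : Fin m → A) (N : ModuleCat.{u} A) {a b : A}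
    (h : RingTheory.Sequence.IsWeaklyRegular N [a, b]) :
    RingTheory.Sequence.IsWeaklyRegular (homology x N m) [a, b] := by
  simp only [RingTheory.Sequence.isWeaklyRegular_cons_iff,
    RingTheory.Sequence.IsWeaklyRegular.nil, and_true] at h ⊢
  obtain ⟨ha, hb⟩ := h
  refine ⟨isSMulRegular_homology_top x N ha, ?_⟩
  have hb' := isSMulRegular_homology_top x (ModuleCat.of A (QuotSMulTop a N)) hb
  have hex := (shortComplex_shortExact x ha.smulShortComplex_shortExact).homology_exact₂ m
  rw [ShortComplex.moduleCat_exact_iff] at hex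
  have hf : ∀ z : homology x N m,
      HomologicalComplex.homologyMap (complexMap x (a • 𝟙 N)) m z = a • z := fun z => by
    rw [homologyMap_complexMap_smul]
    rfl
  let g : homology x N m →ₗ[A] homology x (QuotSMulTop a N) m :=
    (HomologicalComplex.homologyMap (complexMap x (N.smulShortComplex a).g) m).hom
  have hg : ∀ z : homology x N m, g (a • z) = 0 := fun z => by
    rw [← hf]
    exact ((shortComplex_shortExact x ha.smulShortComplex_shortExact).homology_exact₂
      m).moduleCat_range_eq_ker.le ⟨z, rfl⟩
  refine isSMulRegular_iff_right_eq_zero_of_smul.mpr fun q hq => ?_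
  obtain ⟨z, rfl⟩ := Submodule.Quotient.mk_surjective _ q
  rw [← Submodule.Quotient.mk_smul, Submodule.Quotient.mk_eq_zero,
    Submodule.mem_smul_pointwise_iff_exists] at hq
  obtain ⟨y, -, hy⟩ := hq
  have h0 : b • g z = b • (0 : homology x (QuotSMulTop a N) m) := by
    rw [smul_zero, ← map_smul, ← hy]
    exact hg y
  obtain ⟨w, hw⟩ := hex z (hb' h0)
  rw [Submodule.Quotient.mk_eq_zero, Submodule.mem_smul_pointwise_iff_exists]
  exact ⟨w, trivial, (hf w).symm.trans hw⟩

end Koszul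

/-! ### Assembly -/

theorem le_moduleDepth_homology {A : Type u} [CommRing A] [IsLocalRing A]
    (hA : IsCohenMacaulayLocalRing A) {M : Type u} [AddCommGroup M] [Module A M]
    [Module.Finite A M] {d g m : ℕ} (hd : ringKrullDim A = d) (x : Fin m → A)
    (hg : g ≤ idealGrade (Ideal.span (Set.range x)) M) {t : ℕ} (ht : t ≤ 2)
    (hM : projectiveDimension (ModuleCat.of A M) + (g + t : ℕ) ≤ d) :
    t ≤ moduleDepth A (Koszul.homology x M (m - g)) := by
  have := hA.isNoetherianRing
  obtain ⟨rs, hlen, hmem, hrs⟩ := exists_isWeaklyRegular_of_le_idealGrade hg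
  -- For `m < g` the truncated `m - g` is `0`, and all Koszul homology vanishes, so the depth is
  -- `⊤`.
  rcases lt_or_ge m g with hmg | hmg
  · have := ModuleCat.isZero_iff_subsingleton.mp
      (Koszul.VanishesOnTop.of_isWeaklyRegular x (ModuleCat.of A M) rs hmem hrs (m - g) (by lia))
    rw [moduleDepth, idealGrade_eq_top_of_subsingleton]
    exact le_top
  obtain ⟨N, hN, ⟨e⟩, hV⟩ := Koszul.exists_homology_top_iso x (ModuleCat.of A M) rs hmem hrs
    (m - g) (by lia)
  have hdepth : (d : ℕ∞) ≤ moduleDepth A A := by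
    have := hA.depth_eq_dim
    rw [hd] at this
    exact (WithBot.coe_injective this).ge
  obtain ⟨as, haslen, hasmem, has⟩ := exists_isWeaklyRegular_of_le_idealGrade hdepth
  obtain ⟨n, z, hz⟩ := Submodule.fg_iff_exists_fin_generating_family.mp
    (IsNoetherian.noetherian (IsLocalRing.maximalIdeal A))
  replace hz : Ideal.span (Set.range z) = IsLocalRing.maximalIdeal A := hz
  -- The generators `z` of the maximal ideal measure depth, while `x` only defines the homology. The
  -- surplus `rs.length` is used up in passing from `M` to `N`.
  have hVM : Koszul.VanishesOnTop z (ModuleCat.of A M) (t + rs.length) :=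
    .of_projectiveDimension_add_le (hz ▸ hasmem) has _ _ (by rwa [haslen, hlen, add_comm t g])
  obtain ⟨bs, hbslen, hbsmem, hbs⟩ := (hV z t hVM).exists_isWeaklyRegular hz N
  rw [moduleDepth, ← idealGrade_congr _ e.toLinearEquiv, ← hbslen]
  refine le_idealGrade hbsmem ?_
  match bs, hbs with
  | [], _ => exact .nil A _
  | [a], h =>
    rw [RingTheory.Sequence.isWeaklyRegular_singleton_iff] at h ⊢
    exact Koszul.isSMulRegular_homology_top x N h
  | [a, b], h => exact Koszul.isWeaklyRegular_pair_homology_top x N h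
  | _ :: _ :: _ :: _, _ => simp only [List.length_cons] at hbslen; lia

theorem theorem1p10 {A : Type u} [CommRing A] [IsLocalRing A] (hA : IsCohenMacaulayLocalRing A)
    (I : Ideal A) (M : Type u) [AddCommGroup M] [Module A M] [Module.Finite A M]
    (d g m : ℕ) (hd : ringKrullDim A = d) (hg : idealGrade I M = g) (hm : I.spanFinrank = m)
    (x : Fin m → A) (ha : Ideal.span (Set.range x) = I) :
    (projectiveDimension (ModuleCat.of A M) + (g + 1 : ℕ) ≤ d →
      1 ≤ moduleDepth A (Koszul.homology x M (m - g))) ∧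
    (projectiveDimension (ModuleCat.of A M) + (g + 2 : ℕ) ≤ d →
      2 ≤ moduleDepth A (Koszul.homology x M (m - g))) := by
  subst ha
  exact ⟨fun h => by exact_mod_cast le_moduleDepth_homology hA hd x hg.ge (t := 1) (by simp) h,
    fun h => by exact_mod_cast le_moduleDepth_homology hA hd x hg.ge (t := 2) le_rfl h⟩
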